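/- For an integer-valued random variable $X$ with $p_k = \mathbb{P}(X = k)$ and $\alpha \in (1,\infty)$ put $$\Delta_\alpha(X) = \Big( \sum_{k \in \mathbb{Z}} p_k^{\alpha} \Big)^{\frac{2}{1-\alpha}} - 1, \qquad \Delta_\infty(X) = \big(\sup_{k} p_k\big)^{-2} - 1 .$$ A random variable is called Poisson-binomial if it is distributed as a finite sum of independent (not necessarily identically distributed) Bernoulli variables with values in $\{0,1\}$. **Theorem.** Let $\alpha \in [2,\infty]$ and let $\alpha' = \alpha/(\alpha-1)$ (with $\alpha' = 1$ if $\alpha = \infty$). For every $n$ and all independent Poisson-binomial variables $X_1, \dots, X_n$, $$\Delta_\alpha(X_1 + \cdots + X_n) \;\ge\; \frac{\alpha'}{6} \sum_{i=1}^n \Delta_\alpha(X_i).$$ In particular the constant $\alpha'/6$ does not depend on the number $n$ of summands. -/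

import Mathlib

open MeasureTheory ProbabilityTheory
open scoped ENNReal

/-- The Poisson-binomial law on `ℤ` with parameters `p 0, …, p (m - 1) ∈ [0, 1]`: the law of a sum
of `m` independent variables, the `i`-th of which is `1` with probability `p i` and `0` with
probability `1 - p i`. -/
noncomputable def poissonBinomialMeasure {m : ℕ} (p : Fin m → unitInterval) : Measure ℤ :=
  (Measure.pi fun i => bernoulliMeasure (1 : ℤ) 0 (p i)).map fun x : Fin m → ℤ => ∑ i, x i

/-- A random variable is Poisson-binomial if it is distributed as a finite sum of independent (not
necessarily identically distributed) Bernoulli variables. -/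
def IsPoissonBinomial {Ω : Type*} [MeasurableSpace Ω] (X : Ω → ℤ) (P : Measure Ω) : Prop :=
  ∃ (m : ℕ) (p : Fin m → unitInterval), HasLaw X (poissonBinomialMeasure p) P

/-- The functional `Δ_α` of an integer-valued random variable `X`, for `1 < α ≤ ∞`. With
`p_k = P(X = k)` it is `(∑ p_k ^ α) ^ (2 / (1 - α)) - 1` for `α < ∞`, and `(sup p_k) ^ (-2) - 1`
for `α = ∞`. As `α > 1`, the sum converges and lies in `(0, 1]`. -/
noncomputable def renyiDelta {Ω : Type*} [MeasurableSpace Ω] (α : ℝ≥0∞) (X : Ω → ℤ)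
    (P : Measure Ω) : ℝ :=
  if α = ∞ then (⨆ k : ℤ, P.real {ω | X ω = k}) ^ (-2 : ℤ) - 1
  else (∑' k : ℤ, P.real {ω | X ω = k} ^ α.toReal) ^ (2 / (1 - α.toReal)) - 1

/-! Everything passes through A = 4 Var, which is additive, and the function `deltaBound`. Let D =
`deltaBound`. Upper bound: Δ_α ≤ Δ_2 by power means. The squared characteristic function at 2u is ∏
(1 - a_j sin² u) with a_j = 4 p_j (1 - p_j) and ∑ a_j = A. By Parseval its mean is ∑ p_k². Pushing
the a_j towards {0, 1} decreases the mean, so Wallis integrals give Δ_2 ≤ D(A). Since D is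
superadditive, ∑ Δ_α(X_i) ≤ D(A) with A now that of the sum. Lower bound: with V = A/4, the squared
characteristic function of the sum is at most exp(-4V sin² u). Fourier inversion bounds sup p_k, and
Parseval bounds ∑ p_k². Interpolating between the two with θ = (α - 2)/(α - 1) gives Δ_α ≥ (2 - θ)
D(A)/6, and 2 - θ = α'. -/

/-! ### Extremal products. -/

/-- Among products of factors `1 - a i * w` with `a i ∈ [0, 1]` and a prescribed sum of the `a i`,
the smallest one has all but one of the `a i` in `{0, 1}`. -/
lemma exists_pow_mul_le_prod_one_sub {ι : Type*} (s : Finset ι) (a : ι → ℝ)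
    (h0 : ∀ i ∈ s, 0 ≤ a i) (h1 : ∀ i ∈ s, a i ≤ 1) :
    ∃ (n : ℕ) (r : ℝ), 0 ≤ r ∧ r ≤ 1 ∧ ∑ i ∈ s, a i = n + r ∧
      ∀ w : ℝ, 0 ≤ w → w ≤ 1 → (1 - w) ^ n * (1 - r * w) ≤ ∏ i ∈ s, (1 - a i * w) := by
  classical
  induction s using Finset.induction_on with
  | empty => exact ⟨0, 0, by simp⟩
  | insert j s hj ih =>
    obtain ⟨n, r, hr0, hr1, hsum, hle⟩ := ih (fun i hi => h0 i (Finset.mem_insert_of_mem hi))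
      (fun i hi => h1 i (Finset.mem_insert_of_mem hi))
    have ha0 := h0 j (Finset.mem_insert_self j s)
    have ha1 := h1 j (Finset.mem_insert_self j s)
    have key (w : ℝ) (hw0 : 0 ≤ w) (hw1 : w ≤ 1) :
        (1 - a j * w) * ((1 - w) ^ n * (1 - r * w)) ≤ ∏ i ∈ insert j s, (1 - a i * w) := by
      rw [Finset.prod_insert hj]
      exact mul_le_mul_of_nonneg_left (hle w hw0 hw1) (by nlinarith)
    -- The pair (r, a j) becomes (r + a j, 0) or (1, r + a j - 1). The product of the two factors
    -- drops by r (a j) w² or (1 - r)(1 - a j) w² respectively.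
    rcases le_total (r + a j) 1 with h | h
    · refine ⟨n, r + a j, by linarith, h, by rw [Finset.sum_insert hj, hsum]; ring, ?_⟩
      intro w hw0 hw1
      refine le_trans ?_ (key w hw0 hw1)
      have hp : 0 ≤ (1 - w) ^ n := pow_nonneg (by linarith) n
      have : 0 ≤ r * a j * w ^ 2 := by positivity
      nlinarith [mul_nonneg hp this]
    · refine ⟨n + 1, r + a j - 1, by linarith, by linarith, ?_, ?_⟩
      · rw [Finset.sum_insert hj, hsum]; push_cast; ring
      intro w hw0 hw1
      refine le_trans ?_ (key w hw0 hw1)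
      have hp : 0 ≤ (1 - w) ^ n := pow_nonneg (by linarith) n
      have : 0 ≤ (1 - r) * (1 - a j) * w ^ 2 :=
        mul_nonneg (mul_nonneg (by linarith) (by linarith)) (sq_nonneg w)
      rw [pow_succ]
      nlinarith [mul_nonneg hp this]

lemma prod_one_sub_le_exp {ι : Type*} (s : Finset ι) (a : ι → ℝ) (w : ℝ)
    (h : ∀ i ∈ s, a i * w ≤ 1) :
    ∏ i ∈ s, (1 - a i * w) ≤ Real.exp (-((∑ i ∈ s, a i) * w)) := by
  rw [Finset.sum_mul, ← Finset.sum_neg_distrib, Real.exp_sum]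
  refine Finset.prod_le_prod (fun i hi => by linarith [h i hi]) fun i _ => ?_
  linarith [Real.add_one_le_exp (-(a i * w))]

/-! ### The majorant of Δ_2 and Wallis integrals. -/

/-- The function `D (A) = max (3 A) (16 A / 5 - 1 / 5)` bounds `Δ_2` of a Poisson-binomial variable
with variance `A / 4`. -/
noncomputable def deltaBound (A : ℝ) : ℝ := max (3 * A) (16 / 5 * A - 1 / 5)

/-- A convex function vanishing at 0 is superadditive on [0, ∞). -/
lemma sum_deltaBound_le {ι : Type*} (s : Finset ι) (A : ι → ℝ) (h : ∀ i ∈ s, 0 ≤ A i) :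
    ∑ i ∈ s, deltaBound (A i) ≤ deltaBound (∑ i ∈ s, A i) := by
  classical
  induction s using Finset.induction_on with
  | empty => simp [deltaBound]
  | insert j s hj ih =>
    rw [Finset.sum_insert hj, Finset.sum_insert hj]
    have ih := ih fun i hi => h i (Finset.mem_insert_of_mem hi)
    have hB : 0 ≤ ∑ i ∈ s, A i := Finset.sum_nonneg fun i hi => h i (Finset.mem_insert_of_mem hi)
    have hA := h j (Finset.mem_insert_self j s)
    refine (add_le_add_right ih _).trans ?_
    simp only [deltaBound]
    rcases max_cases (3 * A j) (16 / 5 * A j - 1 / 5) with h1 | h1 <;>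
    rcases max_cases (3 * ∑ i ∈ s, A i) (16 / 5 * (∑ i ∈ s, A i) - 1 / 5) with h2 | h2 <;>
    rw [h1.1, h2.1]
    · exact le_max_of_le_left (by linarith)
    all_goals exact le_max_of_le_right (by linarith)

lemma integral_cos_sq_pow_succ (n : ℕ) :
    ∫ u in (0 : ℝ)..Real.pi, (Real.cos u ^ 2) ^ (n + 1) =
      (2 * n + 1) / (2 * n + 2) * ∫ u in (0 : ℝ)..Real.pi, (Real.cos u ^ 2) ^ n := by
  simp_rw [← pow_mul]
  rw [show 2 * (n + 1) = 2 * n + 2 by ring, integral_cos_pow]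
  simp

/-- A Wallis-type lower bound for the mean of `cos ^ (2 n)`. -/
lemma one_le_mul_integral_cos_sq_pow {n : ℕ} (hn : 1 ≤ n) :
    1 ≤ (16 / 5 * n + 4 / 5) *
      ((∫ u in (0 : ℝ)..Real.pi, (Real.cos u ^ 2) ^ n) / Real.pi) ^ 2 := by
  induction n, hn using Nat.le_induction with
  | base =>
    have h := integral_cos_sq_pow_succ 0
    rw [h]
    have := Real.pi_pos
    simp
    field_simp
    norm_num
  | succ n hn ih =>
    rw [integral_cos_sq_pow_succ]
    set c := (∫ u in (0 : ℝ)..Real.pi, (Real.cos u ^ 2) ^ n) with hc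
    refine ih.trans ?_
    rw [mul_div_assoc, mul_pow, ← mul_assoc]
    refine mul_le_mul_of_nonneg_right ?_ (sq_nonneg _)
    have hn' : (0 : ℝ) ≤ n := n.cast_nonneg
    rw [div_pow, mul_div_assoc', le_div_iff₀ (by positivity)]
    push_cast
    -- This is (4n + 1)(2n + 2)² ≤ (4n + 5)(2n + 1)², whose sides differ by 1. The constants 16/5
    -- and 4/5 make the base case n = 1 an equality.
    nlinarith

lemma integral_cos_sq_pow_nonneg (n : ℕ) :
    0 ≤ (∫ u in (0 : ℝ)..Real.pi, (Real.cos u ^ 2) ^ n) / Real.pi :=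
  div_nonneg (intervalIntegral.integral_nonneg Real.pi_pos.le fun u _ => by positivity)
    Real.pi_pos.le

/-- A lower bound for `s` with `1 ≤ Y * s ^ 2`, linear in `Y`: the tangent line of `Y ^ (-1 / 2)`. -/
lemma tangent_le_of_one_le_mul_sq {Y s t : ℝ} (hY : 0 < Y) (hs : 0 ≤ s) (ht : 0 < t)
    (h : 1 ≤ Y * s ^ 2) : t * (3 - Y * t ^ 2) / 2 ≤ s := by
  by_contra! hlt
  have h3 : 0 < t * (3 - Y * t ^ 2) / 2 := hs.trans_lt hlt
  have h4 : 1 < Y * (t * (3 - Y * t ^ 2) / 2) ^ 2 := by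
    refine h.trans_lt (mul_lt_mul_of_pos_left ?_ hY)
    exact pow_lt_pow_left₀ hlt hs (by norm_num)
  have h5 : 0 < 3 - Y * t ^ 2 := by
    by_contra! h6
    nlinarith
  have h6 : 0 < Y * t ^ 2 := by positivity
  -- With z = Y t², 4 - z (3 - z)² = (z - 1)² (4 - z).
  nlinarith [mul_nonneg (sq_nonneg (Y * t ^ 2 - 1)) (show 0 ≤ 4 - Y * t ^ 2 by linarith)]

lemma inv_sq_sub_one_le_deltaBound_of_le_one {A Q : ℝ} (hA0 : 0 ≤ A) (hA1 : A ≤ 1)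
    (h : 1 - A / 2 ≤ Q) : (Q ^ 2)⁻¹ - 1 ≤ deltaBound A := by
  refine le_max_of_le_left ?_
  have hp : 0 < 1 - A / 2 := by linarith
  have : (Q ^ 2)⁻¹ ≤ 1 + 3 * A := by
    rw [inv_le_comm₀ (by nlinarith) (by linarith)]
    refine le_trans ?_ (pow_le_pow_left₀ hp.le h 2)
    rw [inv_le_iff_one_le_mul₀ (by linarith)]
    -- (1 - A/2)² (1 + 3A) = 1 + A (1 - A)(8 - 3A)/4.
    nlinarith [mul_nonneg hA0 (mul_nonneg (sub_nonneg.2 hA1) (show 0 ≤ 8 - 3 * A by linarith))]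
  linarith

/-- The points Y_n and Y_{n+1}, weighted by 1 - r and r, average to Y = 16A/5 + 4/5. Bounding c and
c' below by the tangent of Y^(-1/2) at this Y, which is affine, gives Q ≥ Y^(-1/2). -/
lemma inv_sq_sub_one_le_deltaBound {n : ℕ} (hn : 1 ≤ n) {A Q r c c' : ℝ} (hr0 : 0 ≤ r)
    (hr1 : r ≤ 1) (hA : A = n + r) (hc0 : 0 ≤ c) (hc0' : 0 ≤ c')
    (hc : 1 ≤ (16 / 5 * n + 4 / 5) * c ^ 2) (hc' : 1 ≤ (16 / 5 * (n + 1 : ℝ) + 4 / 5) * c' ^ 2)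
    (h : (1 - r) * c + r * c' ≤ Q) : (Q ^ 2)⁻¹ - 1 ≤ deltaBound A := by
  have hn' : (1 : ℝ) ≤ n := by exact_mod_cast hn
  refine le_max_of_le_right ?_
  have hY : 0 < 16 / 5 * A + 4 / 5 := by linarith
  set Y := 16 / 5 * A + 4 / 5 with hYdef
  set t := (Real.sqrt Y)⁻¹ with ht
  have ht0 : 0 < t := inv_pos.2 (Real.sqrt_pos.2 hY)
  have ht2 : Y * t ^ 2 = 1 := by
    rw [ht, inv_pow, Real.sq_sqrt hY.le, mul_inv_cancel₀ hY.ne']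
  have h1 := tangent_le_of_one_le_mul_sq (by linarith) hc0 ht0 hc
  have h2 := tangent_le_of_one_le_mul_sq (by linarith) hc0' ht0 hc'
  have h3 : t ≤ Q := by
    refine le_trans ?_ h
    refine le_trans (le_of_eq ?_) (add_le_add (mul_le_mul_of_nonneg_left h1 (sub_nonneg.2 hr1))
      (mul_le_mul_of_nonneg_left h2 hr0))
    have : (16 / 5 * (n + r) + 4 / 5) * t ^ 2 = 1 := by rw [← hA]; exact ht2
    linear_combination (t / 2) * this
  have : (Q ^ 2)⁻¹ ≤ Y := by
    rw [inv_le_comm₀ (pow_pos (ht0.trans_le h3) 2) hY]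
    refine le_trans (le_of_eq ?_) (pow_le_pow_left₀ ht0.le h3 2)
    rw [ht, inv_pow, Real.sq_sqrt hY.le]
  linarith

/-! ### Rational majorant of the exponential and its mean. -/

/-- `∫ (1 + z sin² u)⁻² du` over a period, in closed form. -/
lemma integral_inv_one_add_mul_sin_sq_sq {z : ℝ} (hz : 0 ≤ z) :
    ∫ u in (0 : ℝ)..Real.pi, ((1 + z * Real.sin u ^ 2) ^ 2)⁻¹ =
      Real.pi * ((1 + z / 2) / ((1 + z) * Real.sqrt (1 + z))) := by
  set r := Real.sqrt (1 + z) with hr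
  have hr0 : 0 < r := Real.sqrt_pos.2 (by linarith)
  have hr2 : r ^ 2 = 1 + z := Real.sq_sqrt (by linarith)
  have hzr : z = r ^ 2 - 1 := by linarith
  have hD (u : ℝ) : 0 < 1 + z * Real.sin u ^ 2 := by positivity
  have hE (u : ℝ) : 0 < Real.cos u ^ 2 + r * Real.sin u ^ 2 := by
    rcases eq_or_ne (Real.sin u) 0 with h | h
    · have := Real.sin_sq_add_cos_sq u
      rw [h] at this ⊢
      nlinarith
    · positivity
  -- The term u + arctan(…) is a branch of arctan(r tan u) that stays continuous across π/2.
  let F : ℝ → ℝ := fun u => (z * (Real.sin u * Real.cos u / (1 + z * Real.sin u ^ 2)) +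
    (2 + z) * (1 / r * (u + Real.arctan ((r - 1) * (Real.sin u * Real.cos u) /
      (Real.cos u ^ 2 + r * Real.sin u ^ 2))))) / (2 * (1 + z))
  have hF (u : ℝ) : HasDerivAt F ((1 + z * Real.sin u ^ 2) ^ 2)⁻¹ u := by
    have hs := Real.hasDerivAt_sin u
    have hc := Real.hasDerivAt_cos u
    have hsc := hs.mul hc
    have h1 := hsc.div (((hs.pow 2).const_mul z).const_add 1) (hD u).ne'
    have h2 := ((hsc.const_mul (r - 1)).div ((hc.pow 2).add ((hs.pow 2).const_mul r))
      (hE u).ne').arctan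
    have h3 := ((h1.const_mul z).add ((((hasDerivAt_id u).add h2).const_mul (1 / r)).const_mul
      (2 + z))).div_const (2 * (1 + z))
    refine h3.congr_deriv ?_
    have hEu := hE u
    have hDu := hD u
    have htrig := Real.sin_sq_add_cos_sq u
    clear h3 h2 h1 hsc hs hc
    norm_num [Pi.mul_apply, Pi.add_apply, Pi.pow_apply, Pi.div_apply]
    generalize Real.sin u = s at *
    generalize Real.cos u = c at *
    have e1 : 1 + ((r - 1) * (s * c) / (c ^ 2 + r * s ^ 2)) ^ 2 =
        (1 + z * s ^ 2) / (c ^ 2 + r * s ^ 2) ^ 2 := by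
      rw [div_pow, eq_div_iff (by positivity), add_mul, div_mul_cancel₀ _ (by positivity), hzr]
      linear_combination (c ^ 2 + r ^ 2 * s ^ 2 + 1) * htrig
    have hc2 : c ^ 2 = 1 - s ^ 2 := by linarith
    have e2 : 1 / (1 + ((r - 1) * (s * c) / (c ^ 2 + r * s ^ 2)) ^ 2) *
        (((r - 1) * (c * c + s * -s) * (c ^ 2 + r * s ^ 2) -
          (r - 1) * (s * c) * (2 * c * -s + r * (2 * s * c))) / (c ^ 2 + r * s ^ 2) ^ 2) =
        (r - 1) * (c ^ 2 - r * s ^ 2) / (1 + z * s ^ 2) := by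
      rw [e1, one_div_div, div_mul_div_comm, mul_comm, mul_div_mul_right _ _ (by positivity)]
      congr 1
      linear_combination (r - 1) * (c ^ 2 - r * s ^ 2) * htrig
    have e3 : (c * c + s * -s) * (1 + z * s ^ 2) - s * c * (z * (2 * s * c)) =
        1 - 2 * s ^ 2 - z * s ^ 2 := by
      linear_combination (1 - z * s ^ 2) * hc2
    have e4 : 1 / r * (1 + (r - 1) * (c ^ 2 - r * s ^ 2) / (1 + z * s ^ 2)) =
        1 / (1 + z * s ^ 2) := by
      rw [hc2]
      field_simp
      rw [hzr]
      ring
    norm_num at e2 e3 e4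
    rw [e2, e3, e4]
    field_simp
    ring

  rw [intervalIntegral.integral_eq_sub_of_hasDerivAt (fun u _ => hF u)]
  · simp only [F, Real.sin_pi, Real.sin_zero]
    have : (1 + z) ≠ 0 := by positivity
    simp
    field_simp
  · apply Continuous.intervalIntegrable
    exact Continuous.inv₀ (by fun_prop) fun u => (pow_pos (hD u) 2).ne'

lemma exp_neg_le_inv_sq {y : ℝ} (hy : 0 ≤ y) : Real.exp (-y) ≤ ((1 + y / 2) ^ 2)⁻¹ := by
  rw [Real.exp_neg]
  refine inv_anti₀ (by positivity) ?_
  calc (1 + y / 2) ^ 2 ≤ Real.exp (y / 2) ^ 2 :=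
        pow_le_pow_left₀ (by positivity) (by linarith [Real.add_one_le_exp (y / 2)]) 2
    _ = Real.exp y := by rw [← Real.exp_nat_mul]; congr 1; push_cast; ring

/-! ### Numerical inequalities for the lower bound. -/

/-- A weighted geometric mean of two quantities dominates an affine function of the weight. -/
lemma one_add_mul_le_rpow_mul_rpow {θ d x y : ℝ} (hθ0 : 0 ≤ θ) (hθ1 : θ ≤ 1) (hd : 0 ≤ d)
    (hx : (1 + 4 / 3 * d) ^ 2 / (1 + 5 / 3 * d) ≤ x)
    (hy : (1 + 4 / 3 * d) ^ 2 / (1 + 2 / 3 * d) ≤ y) :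
    1 + (2 - θ) * d ≤ x ^ θ * y ^ (1 - θ) := by
  have hP : 0 < 1 + 5 / 3 * d := by positivity
  have hR : 0 < 1 + 2 / 3 * d := by positivity
  set K := (1 + 4 / 3 * d) ^ 2 with hK
  have hK0 : 0 < K := by positivity
  have h1 : (1 + 5 / 3 * d) ^ θ * (1 + 2 / 3 * d) ^ (1 - θ) ≤
      θ * (1 + 5 / 3 * d) + (1 - θ) * (1 + 2 / 3 * d) :=
    Real.geom_mean_le_arith_mean2_weighted hθ0 (by linarith) hP.le hR.le (by ring)
  have h2 : (K / (1 + 5 / 3 * d)) ^ θ * (K / (1 + 2 / 3 * d)) ^ (1 - θ) ≤ x ^ θ * y ^ (1 - θ) :=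
    mul_le_mul (Real.rpow_le_rpow (by positivity) hx hθ0)
      (Real.rpow_le_rpow (by positivity) hy (by linarith)) (by positivity)
      (Real.rpow_nonneg ((div_pos hK0 hP).le.trans hx) _)
  refine le_trans ?_ h2
  rw [Real.div_rpow hK0.le hP.le, Real.div_rpow hK0.le hR.le, div_mul_div_comm,
    ← Real.rpow_add hK0, add_sub_cancel, Real.rpow_one, le_div_iff₀ (by positivity)]
  have h3 : 0 ≤ 1 + (2 - θ) * d := by nlinarith
  refine (mul_le_mul_of_nonneg_left h1 h3).trans ?_
  -- The factors 1 + (2 - θ)d and 1 + (2/3 + θ)d have arithmetic mean 1 + 4d/3, so their product is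
  -- at most K.
  nlinarith [sq_nonneg ((1 + (2 - θ) * d) - (θ * (1 + 5 / 3 * d) + (1 - θ) * (1 + 2 / 3 * d)))]

/-- The right side is the inverse square of the bound on sup p_k. Both sides agree to first order at
V = 0, which fixes 5/3 given 4/3. -/
lemma le_cube_div_sq_fst {V : ℝ} (hV : 0 ≤ V) :
    (1 + 4 / 3 * (deltaBound (4 * V) / 6)) ^ 2 / (1 + 5 / 3 * (deltaBound (4 * V) / 6)) ≤
      (1 + V) ^ 3 / (1 + V / 2) ^ 2 := by
  rcases max_cases (3 * (4 * V)) (16 / 5 * (4 * V) - 1 / 5) with h | h <;>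
  rw [deltaBound, h.1]
  · rw [div_le_div_iff₀ (by positivity) (by positivity)]
    rw [← sub_nonneg]; ring_nf; positivity
  -- V = 1/4 is the kink A = 1 of `deltaBound`; in y, the cleared difference has nonnegative
  -- coefficients.
  · obtain ⟨y, hy, rfl⟩ : ∃ y, 0 ≤ y ∧ V = 1 / 4 + y := ⟨V - 1 / 4, by linarith, by ring⟩
    rw [div_le_div_iff₀ (by linarith) (by positivity)]
    rw [← sub_nonneg]; ring_nf; positivity

lemma le_cube_div_sq_snd {V : ℝ} (hV : 0 ≤ V) :
    (1 + 4 / 3 * (deltaBound (4 * V) / 6)) ^ 2 / (1 + 2 / 3 * (deltaBound (4 * V) / 6)) ≤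
      (1 + 2 * V) ^ 3 / (1 + V) ^ 2 := by
  rcases max_cases (3 * (4 * V)) (16 / 5 * (4 * V) - 1 / 5) with h | h <;>
  rw [deltaBound, h.1]
  · rw [div_le_div_iff₀ (by positivity) (by positivity)]
    rw [← sub_nonneg]; ring_nf; positivity
  · obtain ⟨y, hy, rfl⟩ : ∃ y, 0 ≤ y ∧ V = 1 / 4 + y := ⟨V - 1 / 4, by linarith, by ring⟩
    rw [div_le_div_iff₀ (by linarith) (by positivity)]
    rw [← sub_nonneg]; ring_nf; positivity

/-! ### Fourier analysis on ℤ. -/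

/-- The characteristic function of a law on `ℤ`, evaluated at `2 u`. -/
noncomputable def intCharFun (μ : Measure ℤ) (u : ℝ) : ℂ :=
  ∫ x : ℤ, Complex.exp (2 * u * x * Complex.I) ∂μ

lemma norm_exp_two_mul_mul_I (u : ℝ) (x : ℤ) :
    ‖Complex.exp (2 * u * x * Complex.I)‖ = 1 := by
  rw [show (2 * u * x * Complex.I : ℂ) = ((2 * u * x : ℝ) : ℂ) * Complex.I by push_cast; rfl]
  exact Complex.norm_exp_ofReal_mul_I _

lemma integral_exp_two_mul_mul_I (x : ℤ) :
    ∫ u in (0 : ℝ)..Real.pi, Complex.exp (2 * u * x * Complex.I) =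
      if x = 0 then (Real.pi : ℂ) else 0 := by
  split_ifs with h
  · simp [h]
  · have hc : (2 * x * Complex.I : ℂ) ≠ 0 := by simp [h]
    have := integral_exp_mul_complex (a := 0) (b := Real.pi) hc
    rw [show (fun u : ℝ => Complex.exp (2 * u * x * Complex.I)) =
      fun u : ℝ => Complex.exp (2 * x * Complex.I * u) by ext u; congr 1; ring, this]
    have h2 : Complex.exp (2 * x * Complex.I * Real.pi) = 1 := by
      rw [Complex.exp_eq_one_iff]
      exact ⟨x, by ring⟩
    rw [h2]
    simp

lemma continuous_exp_two_mul_mul_I (x : ℤ) :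
    Continuous fun u : ℝ => Complex.exp (2 * u * x * Complex.I) := by fun_prop

section

variable (μ : Measure ℤ) [IsProbabilityMeasure μ]

lemma measurable_uncurry_exp_two_mul_mul_I :
    Measurable fun q : ℝ × ℤ => Complex.exp (2 * q.1 * q.2 * Complex.I) := by
  refine measurable_from_prod_countable_left fun x => ?_
  exact (continuous_exp_two_mul_mul_I x).measurable

lemma continuous_intCharFun : Continuous (intCharFun μ) := by
  refine continuous_of_dominated (bound := fun _ => 1)
    (fun u => (measurable_of_countable _).aestronglyMeasurable)
    (fun u => Filter.Eventually.of_forall fun x => (norm_exp_two_mul_mul_I u x).le)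
    (integrable_const _) (Filter.Eventually.of_forall continuous_exp_two_mul_mul_I)

lemma integral_intCharFun_mul_swap (g : ℝ → ℂ) (hg : Continuous g) :
    ∫ u in (0 : ℝ)..Real.pi, intCharFun μ u * g u =
      ∫ x : ℤ, (∫ u in (0 : ℝ)..Real.pi, Complex.exp (2 * u * x * Complex.I) * g u) ∂μ := by
  simp_rw [intervalIntegral.integral_of_le Real.pi_pos.le, intCharFun, ← integral_mul_const]
  refine integral_integral_swap ?_
  have hgi : Integrable g (volume.restrict (Set.Ioc 0 Real.pi)) :=
    (hg.integrableOn_Icc).mono_set Set.Ioc_subset_Icc_self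
  have := (hgi.comp_fst μ)
  refine this.bdd_mul (c := 1) (measurable_uncurry_exp_two_mul_mul_I.aestronglyMeasurable)
    (Filter.Eventually.of_forall fun q => (norm_exp_two_mul_mul_I q.1 q.2).le)

/-- Fourier inversion for laws on `ℤ`. -/
lemma integral_intCharFun_mul_exp_neg (k : ℤ) :
    ∫ u in (0 : ℝ)..Real.pi, intCharFun μ u * Complex.exp (2 * u * ((-k : ℤ) : ℂ) * Complex.I) =
      Real.pi * μ.real {k} := by
  rw [integral_intCharFun_mul_swap μ _ (continuous_exp_two_mul_mul_I (-k))]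
  have h (x : ℤ) : ∫ u in (0 : ℝ)..Real.pi, Complex.exp (2 * u * x * Complex.I) *
      Complex.exp (2 * u * ((-k : ℤ) : ℂ) * Complex.I) =
      Set.indicator {k} (fun _ => (Real.pi : ℂ)) x := by
    simp_rw [← Complex.exp_add]
    have := integral_exp_two_mul_mul_I (x - k)
    simp only [sub_eq_zero] at this
    simp only [Set.indicator_apply, Set.mem_singleton_iff]
    rw [← this]
    congr 1 with u
    push_cast
    ring_nf
  simp_rw [h]
  rw [integral_indicator (measurableSet_singleton k)]
  simp [mul_comm, measureReal_def]

lemma pi_mul_measureReal_singleton_le (k : ℤ) :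
    Real.pi * μ.real {k} ≤ ∫ u in (0 : ℝ)..Real.pi, ‖intCharFun μ u‖ := by
  have h := congrArg norm (integral_intCharFun_mul_exp_neg μ k)
  rw [norm_mul, Complex.norm_real, Complex.norm_real, Real.norm_of_nonneg Real.pi_pos.le,
    Real.norm_of_nonneg measureReal_nonneg] at h
  rw [← h]
  refine (intervalIntegral.norm_integral_le_integral_norm Real.pi_pos.le).trans_eq ?_
  simp_rw [norm_mul, norm_exp_two_mul_mul_I, mul_one]

/-- Parseval's identity for laws on `ℤ`. -/
lemma integral_norm_intCharFun_sq :
    ∫ u in (0 : ℝ)..Real.pi, ‖intCharFun μ u‖ ^ 2 =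
      Real.pi * ∑' k : ℤ, μ.real {k} ^ 2 := by
  have h1 := integral_intCharFun_mul_swap μ (fun u => star (intCharFun μ u))
    (continuous_intCharFun μ).star
  have h2 (x : ℤ) : ∫ u in (0 : ℝ)..Real.pi, Complex.exp (2 * u * x * Complex.I) *
      star (intCharFun μ u) = ((Real.pi * μ.real {x} : ℝ) : ℂ) := by
    have := congrArg (starRingEnd ℂ) (integral_intCharFun_mul_exp_neg μ x)
    rw [← intervalIntegral.intervalIntegral_conj] at this
    rw [Complex.ofReal_mul, ← Complex.conj_ofReal, ← Complex.conj_ofReal (μ.real {x}), ← map_mul,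
      ← this]
    congr 1 with u
    rw [map_mul, ← Complex.exp_conj, mul_comm]
    simp [map_ofNat]
  simp_rw [h2] at h1
  rw [integral_complex_ofReal] at h1
  have h3 : ∫ u in (0 : ℝ)..Real.pi, intCharFun μ u * star (intCharFun μ u) =
      ((∫ u in (0 : ℝ)..Real.pi, ‖intCharFun μ u‖ ^ 2 : ℝ) : ℂ) := by
    rw [← intervalIntegral.integral_ofReal]
    congr 1 with u
    have := Complex.mul_conj' (intCharFun μ u)
    simpa using this
  rw [h3, Complex.ofReal_inj] at h1
  rw [h1, integral_const_mul, integral_countable]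
  · simp_rw [smul_eq_mul, pow_two]
  · exact Integrable.of_bound (measurable_of_countable _).aestronglyMeasurable 1
      (Filter.Eventually.of_forall fun x => by
        rw [Real.norm_of_nonneg measureReal_nonneg]; exact measureReal_le_one)

end

/-! ### Power sums of a probability vector. -/

section

variable {p : ℤ → ℝ} (h0 : ∀ k, 0 ≤ p k) (h1 : HasSum p 1)

include h0 h1

lemma le_one_of_hasSum_one (k : ℤ) : p k ≤ 1 := le_hasSum h1 k fun j _ => h0 j

lemma summable_rpow_of_hasSum_one {a : ℝ} (ha : 1 ≤ a) : Summable fun k => p k ^ a := by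
  refine h1.summable.of_nonneg_of_le (fun k => Real.rpow_nonneg (h0 k) a) fun k => ?_
  exact (Real.rpow_le_rpow_of_exponent_ge' (h0 k) (le_one_of_hasSum_one h0 h1 k) zero_le_one
    ha).trans_eq (Real.rpow_one _)

lemma summable_sq_of_hasSum_one : Summable fun k => p k ^ 2 := by
  simpa using summable_rpow_of_hasSum_one h0 h1 one_le_two

lemma tsum_sq_pos_of_hasSum_one : 0 < ∑' k, p k ^ 2 := by
  obtain ⟨k, hk⟩ : ∃ k, 0 < p k := by
    by_contra! h
    have : p = 0 := funext fun k => le_antisymm (h k) (h0 k)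
    rw [this] at h1
    exact zero_ne_one (hasSum_zero.unique h1)
  exact (summable_sq_of_hasSum_one h0 h1).tsum_pos (fun k => sq_nonneg _) k (by positivity)

/-- Monotonicity of power means, with weights and values both given by a probability vector. -/
lemma tsum_sq_rpow_le_tsum_rpow {a : ℝ} (ha : 2 ≤ a) :
    (∑' k, p k ^ 2) ^ (a - 1) ≤ ∑' k, p k ^ a := by
  have hQ := tsum_sq_pos_of_hasSum_one h0 h1
  have hsq := (summable_sq_of_hasSum_one h0 h1).hasSum
  set Q := ∑' k, p k ^ 2 with hQdef
  have hlin : HasSum (fun k => Q ^ (a - 1) * (p k + (a - 1) * (p k ^ 2 / Q - p k)))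
      (Q ^ (a - 1) * (1 + (a - 1) * (Q / Q - 1))) :=
    (h1.add (((hsq.div_const Q).sub h1).mul_left (a - 1))).mul_left _
  rw [div_self hQ.ne', sub_self, mul_zero, add_zero, mul_one] at hlin
  refine hasSum_le (fun k => ?_) hlin
    (summable_rpow_of_hasSum_one h0 h1 (one_le_two.trans ha)).hasSum
  -- Bernoulli's inequality is the tangent bound for x^(a-1) at x = Q, the p-mean of p; averaging
  -- against p kills the linear term.
  have hb := one_add_mul_self_le_rpow_one_add (s := p k / Q - 1) (p := a - 1)
    (by linarith [div_nonneg (h0 k) hQ.le]) (by linarith)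
  rw [add_sub_cancel, Real.div_rpow (h0 k) hQ.le, le_div_iff₀ (Real.rpow_pos_of_pos hQ _)] at hb
  have hpow : p k ^ a = p k * p k ^ (a - 1) := by
    have := Real.rpow_add_of_nonneg (h0 k) zero_le_one (show 0 ≤ a - 1 by linarith)
    rwa [add_sub_cancel, Real.rpow_one] at this
  rw [hpow]
  refine (le_of_eq ?_).trans (mul_le_mul_of_nonneg_left hb (h0 k))
  ring

lemma tsum_rpow_rpow_le {a : ℝ} (ha : 2 ≤ a) :
    (∑' k, p k ^ a) ^ (2 / (1 - a)) ≤ ((∑' k, p k ^ 2) ^ 2)⁻¹ := by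
  have hQ := tsum_sq_pos_of_hasSum_one h0 h1
  refine (Real.rpow_le_rpow_of_nonpos (Real.rpow_pos_of_pos hQ _)
    (tsum_sq_rpow_le_tsum_rpow h0 h1 ha)
    (div_nonpos_of_nonneg_of_nonpos zero_le_two (by linarith))).trans_eq ?_
  rw [← Real.rpow_mul hQ.le, show (a - 1) * (2 / (1 - a)) = -2 by
    have : 1 - a ≠ 0 := by linarith
    field_simp
    ring, Real.rpow_neg hQ.le]
  norm_num

lemma tsum_sq_le_iSup : ∑' k, p k ^ 2 ≤ ⨆ k, p k := by
  have hbdd : BddAbove (Set.range p) :=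
    ⟨1, by rintro _ ⟨k, rfl⟩; exact le_one_of_hasSum_one h0 h1 k⟩
  refine hasSum_le (fun k => ?_) (summable_sq_of_hasSum_one h0 h1).hasSum
    (by simpa using h1.mul_left (⨆ k, p k))
  rw [pow_two]
  exact mul_le_mul_of_nonneg_right (le_ciSup hbdd k) (h0 k)

/-- Interpolation: p_k^a ≤ b^(a-2) p_k², then raise to the negative power 2/(1 - a). -/
lemma rpow_mul_rpow_le_tsum_rpow_rpow {a b q : ℝ} (ha : 2 ≤ a) (hb : 0 < b) (hq : 0 < q)
    (hpb : ∀ k, p k ≤ b) (hpq : ∑' k, p k ^ 2 ≤ q) :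
    ((b ^ 2)⁻¹) ^ ((a - 2) / (a - 1)) * ((q ^ 2)⁻¹) ^ (1 - (a - 2) / (a - 1)) ≤
      (∑' k, p k ^ a) ^ (2 / (1 - a)) := by
  have hQ := tsum_sq_pos_of_hasSum_one h0 h1
  have ha1 : a - 1 ≠ 0 := by linarith
  have ha1' : 1 - a ≠ 0 := by linarith
  have hle : ∑' k, p k ^ a ≤ b ^ (a - 2) * q := by
    refine le_trans ?_ (mul_le_mul_of_nonneg_left hpq (Real.rpow_nonneg hb.le _))
    rw [← tsum_mul_left]
    refine (summable_rpow_of_hasSum_one h0 h1 (one_le_two.trans ha)).tsum_le_tsum (fun k => ?_)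
      ((summable_sq_of_hasSum_one h0 h1).mul_left _)
    have := Real.rpow_add_of_nonneg (h0 k) (show 0 ≤ a - 2 by linarith) zero_le_two
    rw [sub_add_cancel, Real.rpow_two] at this
    rw [this]
    exact mul_le_mul_of_nonneg_right (Real.rpow_le_rpow (h0 k) (hpb k) (by linarith))
      (sq_nonneg _)
  refine le_trans (le_of_eq ?_) (Real.rpow_le_rpow_of_nonpos
    ((Real.rpow_pos_of_pos hQ _).trans_le (tsum_sq_rpow_le_tsum_rpow h0 h1 ha)) hle
    (div_nonpos_of_nonneg_of_nonpos zero_le_two (by linarith)))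
  rw [Real.mul_rpow (Real.rpow_nonneg hb.le _) hq.le, ← Real.rpow_mul hb.le]
  have hinv (x : ℝ) (hx : 0 < x) (e : ℝ) : ((x ^ 2)⁻¹) ^ e = x ^ (-2 * e) := by
    rw [Real.rpow_mul hx.le, Real.rpow_neg hx.le, Real.rpow_two]
  rw [hinv b hb, hinv q hq]
  congr 2 <;> field_simp <;> ring

end

/-! ### From characteristic function bounds to bounds on the law. -/

/-- The bound `(1 + z / 2) / (1 + z) ^ (3 / 2)`, the mean of `(1 + z sin² u)⁻²`. -/
noncomputable def meanInvSq (z : ℝ) : ℝ := (1 + z / 2) / ((1 + z) * Real.sqrt (1 + z))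

lemma meanInvSq_pos {z : ℝ} (hz : 0 ≤ z) : 0 < meanInvSq z := by
  have : 0 < Real.sqrt (1 + z) := Real.sqrt_pos.2 (by linarith)
  unfold meanInvSq
  positivity

lemma inv_meanInvSq_sq {z : ℝ} (hz : 0 ≤ z) :
    (meanInvSq z ^ 2)⁻¹ = (1 + z) ^ 3 / (1 + z / 2) ^ 2 := by
  rw [meanInvSq, div_pow, inv_div, mul_pow, Real.sq_sqrt (by linarith)]
  ring

section

variable (μ : Measure ℤ) [IsProbabilityMeasure μ]

lemma hasSum_measureReal_singleton : HasSum (fun k : ℤ => μ.real {k}) 1 := by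
  have h : ∑' k : ℤ, μ {k} = 1 := by
    rw [← measure_iUnion (fun i j hij => by simpa using hij) fun k => measurableSet_singleton k,
      Set.iUnion_of_singleton, measure_univ]
  have hs := ENNReal.hasSum_toReal (f := fun k : ℤ => μ {k}) (by rw [h]; exact ENNReal.one_ne_top)
  rwa [← ENNReal.tsum_toReal_eq fun k => measure_ne_top μ {k}, h, ENNReal.toReal_one] at hs

lemma continuous_inv_one_add_mul_sin_sq_sq {z : ℝ} (hz : 0 ≤ z) :
    Continuous fun u : ℝ => ((1 + z * Real.sin u ^ 2) ^ 2)⁻¹ :=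
  Continuous.inv₀ (by fun_prop) fun u => by positivity

lemma measureReal_singleton_le_meanInvSq {V : ℝ} (hV : 0 ≤ V)
    (h : ∀ u, ‖intCharFun μ u‖ ^ 2 ≤ Real.exp (-(4 * V * Real.sin u ^ 2))) (k : ℤ) :
    μ.real {k} ≤ meanInvSq V := by
  refine le_of_mul_le_mul_left ?_ Real.pi_pos
  refine (pi_mul_measureReal_singleton_le μ k).trans ?_
  rw [meanInvSq, ← integral_inv_one_add_mul_sin_sq_sq hV]
  refine intervalIntegral.integral_mono_on Real.pi_pos.le
    ((continuous_intCharFun μ).norm.intervalIntegrable _ _)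
    ((continuous_inv_one_add_mul_sin_sq_sq hV).intervalIntegrable _ _) fun u _ => ?_
  have hy : 0 ≤ 2 * V * Real.sin u ^ 2 := by positivity
  refine le_trans ?_ ((exp_neg_le_inv_sq hy).trans_eq (by ring_nf))
  refine abs_le_of_sq_le_sq' ?_ (Real.exp_nonneg _) |>.2
  refine (h u).trans_eq ?_
  rw [← Real.exp_nat_mul]
  congr 1
  push_cast
  ring

lemma tsum_measureReal_singleton_sq_le_meanInvSq {V : ℝ} (hV : 0 ≤ V)
    (h : ∀ u, ‖intCharFun μ u‖ ^ 2 ≤ Real.exp (-(4 * V * Real.sin u ^ 2))) :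
    ∑' k : ℤ, μ.real {k} ^ 2 ≤ meanInvSq (2 * V) := by
  refine le_of_mul_le_mul_left ?_ Real.pi_pos
  rw [← integral_norm_intCharFun_sq, meanInvSq, ← integral_inv_one_add_mul_sin_sq_sq (by positivity)]
  refine intervalIntegral.integral_mono_on Real.pi_pos.le
    (((continuous_intCharFun μ).norm.pow 2).intervalIntegrable _ _)
    ((continuous_inv_one_add_mul_sin_sq_sq (by positivity)).intervalIntegrable _ _) fun u _ => ?_
  have hy : 0 ≤ 4 * V * Real.sin u ^ 2 := by positivity
  exact (h u).trans ((exp_neg_le_inv_sq hy).trans_eq (by ring_nf))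

lemma inv_tsum_sq_sub_one_le_deltaBound {ι : Type*} (s : Finset ι) (a : ι → ℝ)
    (h0 : ∀ i ∈ s, 0 ≤ a i) (h1 : ∀ i ∈ s, a i ≤ 1)
    (h : ∀ u, ‖intCharFun μ u‖ ^ 2 = ∏ i ∈ s, (1 - a i * Real.sin u ^ 2)) :
    ((∑' k : ℤ, μ.real {k} ^ 2) ^ 2)⁻¹ - 1 ≤ deltaBound (∑ i ∈ s, a i) := by
  obtain ⟨n, r, hr0, hr1, hsum, hle⟩ := exists_pow_mul_le_prod_one_sub s a h0 h1
  set c : ℕ → ℝ := fun n => (∫ u in (0 : ℝ)..Real.pi, (Real.cos u ^ 2) ^ n) / Real.pi with hc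
  have hcc (n : ℕ) : Real.pi * c n = ∫ u in (0 : ℝ)..Real.pi, (Real.cos u ^ 2) ^ n :=
    mul_div_cancel₀ _ Real.pi_pos.ne'
  have hi (n : ℕ) : IntervalIntegrable (fun u => (Real.cos u ^ 2) ^ n) volume 0 Real.pi :=
    Continuous.intervalIntegrable (by fun_prop) _ _
  -- With w = sin² u, 1 - r w = (1 - r) + r cos² u splits the extremal product into two Wallis
  -- integrands.
  have key : (1 - r) * c n + r * c (n + 1) ≤ ∑' k : ℤ, μ.real {k} ^ 2 := by
    refine le_of_mul_le_mul_left ?_ Real.pi_pos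
    rw [← integral_norm_intCharFun_sq, mul_add, mul_left_comm, mul_left_comm Real.pi r, hcc, hcc,
      ← intervalIntegral.integral_const_mul, ← intervalIntegral.integral_const_mul,
      ← intervalIntegral.integral_add ((hi n).const_mul _) ((hi (n + 1)).const_mul _)]
    refine intervalIntegral.integral_mono_on Real.pi_pos.le
      (((hi n).const_mul _).add ((hi (n + 1)).const_mul _))
      (((continuous_intCharFun μ).norm.pow 2).intervalIntegrable _ _) fun u _ => ?_
    rw [h u]
    refine le_trans (le_of_eq ?_) (hle (Real.sin u ^ 2) (sq_nonneg _) (Real.sin_sq_le_one u))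
    rw [← Real.cos_sq', Real.sin_sq]
    ring
  -- The Wallis bound fails at n = 0, where the linear piece 3A takes over.
  rcases Nat.eq_zero_or_pos n with rfl | hn
  · have hc0 : c 0 = 1 := by simp [hc, Real.pi_pos.ne']
    have hc1 : c 1 = 1 / 2 := by
      have := integral_cos_sq_pow_succ 0
      simp only [hc]
      rw [zero_add] at this
      rw [this]
      simp [Real.pi_pos.ne']
    rw [zero_add, hc0, hc1] at key
    rw [Nat.cast_zero, zero_add] at hsum
    exact inv_sq_sub_one_le_deltaBound_of_le_one (hsum ▸ hr0) (hsum ▸ hr1) (by linarith)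
  · refine inv_sq_sub_one_le_deltaBound hn hr0 hr1 hsum (integral_cos_sq_pow_nonneg n)
      (integral_cos_sq_pow_nonneg (n + 1)) (one_le_mul_integral_cos_sq_pow hn) ?_ key
    have := one_le_mul_integral_cos_sq_pow (n := n + 1) (by omega)
    push_cast at this
    exact this

end

/-! ### Characteristic functions of Poisson-binomial laws. -/

lemma intCharFun_poissonBinomialMeasure {m : ℕ} (p : Fin m → unitInterval) (u : ℝ) :
    intCharFun (poissonBinomialMeasure p) u =
      ∏ j, ((p j : ℂ) * Complex.exp (2 * u * Complex.I) + (1 - (p j : ℂ))) := by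
  rw [intCharFun, poissonBinomialMeasure, integral_map (measurable_of_countable _).aemeasurable
    (measurable_of_countable _).aestronglyMeasurable]
  have h (x : Fin m → ℤ) : Complex.exp (2 * u * ((∑ i, x i : ℤ) : ℂ) * Complex.I) =
      ∏ i, Complex.exp (2 * u * (x i) * Complex.I) := by
    rw [← Complex.exp_sum]
    push_cast
    rw [Finset.mul_sum, Finset.sum_mul]
  simp_rw [h]
  rw [integral_fintype_prod_eq_prod
    (f := fun (_ : Fin m) (x : ℤ) => Complex.exp (2 * u * x * Complex.I))]
  refine Finset.prod_congr rfl fun j _ => ?_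
  rw [integral_bernoulliMeasure]
  simp [Complex.real_smul]

lemma norm_bernoulli_charFun_sq (q u : ℝ) :
    ‖(q : ℂ) * Complex.exp (2 * u * Complex.I) + (1 - (q : ℂ))‖ ^ 2 =
      1 - 4 * q * (1 - q) * Real.sin u ^ 2 := by
  rw [← Complex.normSq_eq_norm_sq, show (2 * u * Complex.I : ℂ) = ((2 * u : ℝ) : ℂ) * Complex.I by
    push_cast; rfl, Complex.exp_mul_I, ← Complex.ofReal_cos, ← Complex.ofReal_sin,
    Complex.normSq_apply]
  simp only [Complex.add_re, Complex.add_im, Complex.re_ofReal_mul, Complex.im_ofReal_mul,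
    Complex.mul_I_re, Complex.mul_I_im, Complex.ofReal_re, Complex.ofReal_im, Complex.sub_re,
    Complex.sub_im, Complex.one_re, Complex.one_im]
  have h1 : Real.cos (2 * u) = 1 - 2 * Real.sin u ^ 2 := by
    rw [Real.cos_two_mul, Real.cos_sq']
    ring
  have h2 := Real.sin_sq_add_cos_sq (2 * u)
  linear_combination q ^ 2 * h2 + 2 * q * (1 - q) * h1

lemma exists_norm_intCharFun_sq_eq_prod {m : ℕ} (p : Fin m → unitInterval) :
    ∃ a : Fin m → ℝ, (∀ j, 0 ≤ a j) ∧ (∀ j, a j ≤ 1) ∧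
      ∀ u, ‖intCharFun (poissonBinomialMeasure p) u‖ ^ 2 = ∏ j, (1 - a j * Real.sin u ^ 2) := by
  refine ⟨fun j => 4 * p j * (1 - p j), fun j => ?_, fun j => ?_, fun u => ?_⟩
  · have := (p j).2.1
    have := (p j).2.2
    exact mul_nonneg (by linarith) (by linarith)
  · nlinarith [sq_nonneg (2 * (p j : ℝ) - 1)]
  · rw [intCharFun_poissonBinomialMeasure, norm_prod, ← Finset.prod_pow]
    exact Finset.prod_congr rfl fun j _ => norm_bernoulli_charFun_sq _ _

/-! ### The two bounds on Δ_α and the conclusion. -/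

section

variable {Ω : Type*} [MeasurableSpace Ω] {P : Measure Ω}

lemma measureReal_setOf_eq {X : Ω → ℤ} (hX : AEMeasurable X P) (k : ℤ) :
    P.real {ω | X ω = k} = (P.map X).real {k} := by
  rw [map_measureReal_apply_of_aemeasurable hX (measurableSet_singleton k)]
  rfl

lemma intCharFun_map_sum {n : ℕ} {X : Fin n → Ω → ℤ} (hX : ∀ i, AEMeasurable (X i) P)
    (hindep : iIndepFun X P) (u : ℝ) :
    intCharFun (P.map fun ω => ∑ i, X i ω) u = ∏ i, intCharFun (P.map (X i)) u := by
  have hS : AEMeasurable (fun ω => ∑ i, X i ω) P := Finset.aemeasurable_fun_sum _ fun i _ => hX i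
  have hf : Measurable fun x : ℤ => Complex.exp (2 * u * x * Complex.I) := measurable_of_countable _
  simp_rw [intCharFun]
  rw [integral_map hS hf.aestronglyMeasurable]
  simp_rw [fun i => integral_map (hX i) hf.aestronglyMeasurable]
  rw [← hindep.integral_fun_prod_comp hX fun i => hf.aestronglyMeasurable]
  congr 1 with ω
  rw [← Complex.exp_sum]
  push_cast
  rw [Finset.mul_sum, Finset.sum_mul]

lemma renyiDelta_le [IsProbabilityMeasure P] {α : ℝ≥0∞} (hα : 2 ≤ α) {X : Ω → ℤ} (hX : AEMeasurable X P) :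
    renyiDelta α X P ≤ ((∑' k : ℤ, (P.map X).real {k} ^ 2) ^ 2)⁻¹ - 1 := by
  have := Measure.isProbabilityMeasure_map hX
  have h0 (k : ℤ) : 0 ≤ (P.map X).real {k} := measureReal_nonneg
  have h1 := hasSum_measureReal_singleton (P.map X)
  simp only [renyiDelta, measureReal_setOf_eq hX]
  split_ifs with h
  · rw [zpow_neg]
    have hQ := tsum_sq_pos_of_hasSum_one h0 h1
    have := inv_anti₀ (pow_pos hQ 2) (pow_le_pow_left₀ hQ.le (tsum_sq_le_iSup h0 h1) 2)
    exact sub_le_sub_right (mod_cast this) 1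
  · have ha : 2 ≤ α.toReal := by simpa using ENNReal.toReal_mono h hα
    exact sub_le_sub_right (tsum_rpow_rpow_le h0 h1 ha) 1

lemma conjExponent_mul_le_renyiDelta [IsProbabilityMeasure P] {α : ℝ≥0∞} (hα : 2 ≤ α) {X : Ω → ℤ} (hX : AEMeasurable X P)
    {V : ℝ} (hV : 0 ≤ V)
    (h : ∀ u, ‖intCharFun (P.map X) u‖ ^ 2 ≤ Real.exp (-(4 * V * Real.sin u ^ 2))) :
    α.conjExponent.toReal * (deltaBound (4 * V) / 6) ≤ renyiDelta α X P := by
  have := Measure.isProbabilityMeasure_map hX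
  have h0 (k : ℤ) : 0 ≤ (P.map X).real {k} := measureReal_nonneg
  have h1 := hasSum_measureReal_singleton (P.map X)
  have hM := measureReal_singleton_le_meanInvSq (P.map X) hV h
  have hQ := tsum_measureReal_singleton_sq_le_meanInvSq (P.map X) hV h
  have hd : 0 ≤ deltaBound (4 * V) / 6 := by
    have : 3 * (4 * V) ≤ deltaBound (4 * V) := le_max_left _ _
    linarith
  have hb := meanInvSq_pos hV
  have hq := meanInvSq_pos (z := 2 * V) (by positivity)
  have hx := le_cube_div_sq_fst hV
  have hy := le_cube_div_sq_snd hV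
  rw [← inv_meanInvSq_sq hV] at hx
  rw [show (1 + V) ^ 2 = (1 + 2 * V / 2) ^ 2 by ring, ← inv_meanInvSq_sq (by positivity)] at hy
  simp only [renyiDelta, measureReal_setOf_eq hX]
  split_ifs with hα'
  -- α = ∞ is the endpoint θ = 1, where only the bound on sup p_k enters.
  · have hθ := one_add_mul_le_rpow_mul_rpow zero_le_one le_rfl hd hx hy
    rw [sub_self, Real.rpow_zero, Real.rpow_one, mul_one] at hθ
    have hsup : ⨆ k : ℤ, (P.map X).real {k} ≤ meanInvSq V := ciSup_le hM
    have hpos := (tsum_sq_pos_of_hasSum_one h0 h1).trans_le (tsum_sq_le_iSup h0 h1)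
    have hinv := inv_anti₀ (pow_pos hpos 2) (pow_le_pow_left₀ hpos.le hsup 2)
    rw [zpow_neg]
    have hc : α.conjExponent.toReal = 1 := by simp [hα', ENNReal.conjExponent]
    rw [hc, le_sub_iff_add_le]
    refine le_trans ?_ (show _ ≤ _ from mod_cast hinv)
    linarith
  · have ha : 2 ≤ α.toReal := by simpa using ENNReal.toReal_mono hα' hα
    have ha1 : 0 < α.toReal - 1 := by linarith
    have hθ := one_add_mul_le_rpow_mul_rpow (θ := (α.toReal - 2) / (α.toReal - 1))
      (div_nonneg (by linarith) ha1.le) ((div_le_one ha1).2 (by linarith)) hd hx hy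
    have hle := hθ.trans (rpow_mul_rpow_le_tsum_rpow_rpow h0 h1 ha hb hq hM hQ)
    have hc : α.conjExponent.toReal = 2 - (α.toReal - 2) / (α.toReal - 1) := by
      have h1α : 1 ≤ α := le_trans (by norm_num) hα
      have hne : α - 1 ≠ 0 := by
        rw [Ne, tsub_eq_zero_iff_le, not_le]
        exact lt_of_lt_of_le (by norm_num) hα
      rw [ENNReal.conjExponent, ENNReal.toReal_add ENNReal.one_ne_top (ENNReal.inv_ne_top.2 hne),
        ENNReal.toReal_inv, ENNReal.toReal_sub_of_le h1α hα', ENNReal.toReal_one]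
      field_simp
      ring
    rw [hc, le_sub_iff_add_le, add_comm]
    exact hle

end

theorem mainTheorem4 (α : ℝ≥0∞) (hα : 2 ≤ α) {Ω : Type*} [MeasurableSpace Ω]
    (P : Measure Ω) [IsProbabilityMeasure P] (n : ℕ) (X : Fin n → Ω → ℤ)
    (hX : ∀ i, IsPoissonBinomial (X i) P) (hindep : iIndepFun X P) :
    α.conjExponent.toReal / 6 * ∑ i, renyiDelta α (X i) P ≤
      renyiDelta α (fun ω => ∑ i, X i ω) P := by
  have hXm (i : Fin n) : AEMeasurable (X i) P := by
    obtain ⟨m, p, h⟩ := hX i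
    exact h.aemeasurable
  have hprob (i : Fin n) : IsProbabilityMeasure (P.map (X i)) :=
    Measure.isProbabilityMeasure_map (hXm i)
  have hprod (i : Fin n) : ∃ (m : ℕ) (a : Fin m → ℝ), (∀ j, 0 ≤ a j) ∧ (∀ j, a j ≤ 1) ∧
      ∀ u, ‖intCharFun (P.map (X i)) u‖ ^ 2 = ∏ j, (1 - a j * Real.sin u ^ 2) := by
    obtain ⟨m, p, h⟩ := hX i
    rw [h.map_eq]
    exact ⟨m, exists_norm_intCharFun_sq_eq_prod p⟩
  choose m a ha0 ha1 ha using hprod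
  set A : Fin n → ℝ := fun i => ∑ j, a i j with hA
  have hA0 (i : Fin n) : 0 ≤ A i := Finset.sum_nonneg fun j _ => ha0 i j
  have hupper (i : Fin n) : renyiDelta α (X i) P ≤ deltaBound (A i) :=
    (renyiDelta_le hα (hXm i)).trans (inv_tsum_sq_sub_one_le_deltaBound (P.map (X i)) Finset.univ
      (a i) (fun j _ => ha0 i j) (fun j _ => ha1 i j) (ha i))
  have hsum : ∑ i, renyiDelta α (X i) P ≤ deltaBound (∑ i, A i) :=
    (Finset.sum_le_sum fun i _ => hupper i).trans
      (sum_deltaBound_le Finset.univ A fun i _ => hA0 i)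
  have hexp (u : ℝ) : ‖intCharFun (P.map fun ω => ∑ i, X i ω) u‖ ^ 2 ≤
      Real.exp (-(4 * ((∑ i, A i) / 4) * Real.sin u ^ 2)) := by
    rw [intCharFun_map_sum hXm hindep, norm_prod, ← Finset.prod_pow,
      mul_div_cancel₀ _ (four_ne_zero), Finset.sum_mul, ← Finset.sum_neg_distrib, Real.exp_sum]
    refine Finset.prod_le_prod (fun i _ => sq_nonneg _) fun i _ => ?_
    rw [ha i]
    exact prod_one_sub_le_exp _ _ _ fun j _ =>
      mul_le_one₀ (ha1 i j) (sq_nonneg _) (Real.sin_sq_le_one u)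
  have hS : AEMeasurable (fun ω => ∑ i, X i ω) P := Finset.aemeasurable_fun_sum _ fun i _ => hXm i
  have hlower := conjExponent_mul_le_renyiDelta hα hS
    (div_nonneg (Finset.sum_nonneg fun i _ => hA0 i) (by norm_num)) hexp
  refine le_trans ?_ hlower
  rw [mul_div_cancel₀ _ (four_ne_zero), mul_div_assoc', div_mul_eq_mul_div]
  exact div_le_div_of_nonneg_right
    (mul_le_mul_of_nonneg_left hsum ENNReal.toReal_nonneg) (by norm_num)
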